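/- Let $K$ be a Noetherian commutative ring and let $k,d\ge 0$ be integers. Let $X=\operatorname{Spec} K[x_{i,j} : i\in\{1,\dots,k\},\, j\in\mathbb N]$ be the $K$-scheme of $k\times\mathbb N$-matrices and $Y=\operatorname{Spec} K[y_{i_1,\dots,i_d} : i_1,\dots,i_d\in\mathbb N]$ the $K$-scheme of $\mathbb N\times\cdots\times\mathbb N$-tensors ($d$ factors). The group $\operatorname{Sym}(\mathbb N)$ of permutations of $\mathbb N$ acts on the coordinate rings by $K$-algebra automorphisms with $\sigma x_{i,j}=x_{i,\sigma(j)}$ and $\sigma y_{i_1,\dots,i_d}=y_{\sigma(i_1),\dots,\sigma(i_d)}$, and correspondingly on $X$ and $Y$. Let $\varphi:X\to Y$ be a $\operatorname{Sym}(\mathbb N)$-equivariant morphism of $K$-schemes, and let $\overline{\operatorname{Im}(\varphi)}\subseteq Y$ be the Zariski closure of its image. Then: 1. $\overline{\operatorname{Im}(\varphi)}$ is defined set-theoretically by finitely many $\operatorname{Sym}(\mathbb N)$-orbits of equations: there is a finite set $F\subseteq K[y_{i_1,\dots,i_d} : i_1,\dots,i_d\in\mathbb N]$ such that $\overline{\operatorname{Im}(\varphi)}$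 is the set of points of $Y$ at which all $\sigma f$ with $f\in F$ and $\sigma\in\operatorname{Sym}(\mathbb N)$ vanish. 2. $\overline{\operatorname{Im}(\varphi)}$ is topologically $\operatorname{Sym}(\mathbb N)$-Noetherian: every descending chain $\overline{\operatorname{Im}(\varphi)}\supseteq X_1\supseteq X_2\supseteq\cdots$ of $\operatorname{Sym}(\mathbb N)$-stable closed subsets of $Y$ (equivalently, of $\operatorname{Sym}(\mathbb N)$-stable reduced closed subschemes) stabilises. -/

import Mathlib

open CategoryTheory AlgebraicGeometry

universe u

noncomputable section

/-- The left action of `Sym(ℕ)` on the polynomial ring `K[x_{i,j} : i ∈ [k], j ∈ ℕ]`,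
with `σ • x_{i,j} = x_{i,σ(j)}`. -/
def matrixRingAct (K : Type u) [CommRing K] (k : ℕ) (σ : Equiv.Perm ℕ) :
    MvPolynomial (Fin k × ℕ) K →ₐ[K] MvPolynomial (Fin k × ℕ) K :=
  MvPolynomial.rename (fun p => (p.1, σ p.2))

/-- The left action of `Sym(ℕ)` on the polynomial ring `K[y_{i_1,…,i_d} : i_1,…,i_d ∈ ℕ]`,
with `σ • y_{i_1,…,i_d} = y_{σ(i_1),…,σ(i_d)}`. -/
def tensorRingAct (K : Type u) [CommRing K] (d : ℕ) (σ : Equiv.Perm ℕ) :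
    MvPolynomial (Fin d → ℕ) K →ₐ[K] MvPolynomial (Fin d → ℕ) K :=
  MvPolynomial.rename (fun i => fun l => σ (i l))

/-- The `K`-scheme of `k × ℕ`-matrices. -/
abbrev matrixScheme (K : Type u) [CommRing K] (k : ℕ) : Over (Spec (CommRingCat.of K)) :=
  Over.mk (Spec.map (CommRingCat.ofHom (algebraMap K (MvPolynomial (Fin k × ℕ) K))))

/-- The `K`-scheme of `ℕ × ⋯ × ℕ`-tensors, with `d` factors. -/
abbrev tensorScheme (K : Type u) [CommRing K] (d : ℕ) : Over (Spec (CommRingCat.of K)) :=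
  Over.mk (Spec.map (CommRingCat.ofHom (algebraMap K (MvPolynomial (Fin d → ℕ) K))))

/-- The left action of `Sym(ℕ)` on the scheme of `k × ℕ`-matrices by permuting columns:
on coordinates, `(σ • M)_{i,j} = M_{i,σ⁻¹(j)}`. -/
def matrixAct (K : Type u) [CommRing K] (k : ℕ) (σ : Equiv.Perm ℕ) :
    matrixScheme K k ⟶ matrixScheme K k :=
  Over.homMk (Spec.map (CommRingCat.ofHom (matrixRingAct K k σ⁻¹).toRingHom)) (by
    dsimp only [Over.mk_left, Over.mk_hom]
    rw [← Spec.map_comp, ← CommRingCat.ofHom_comp]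
    congr 2
    exact (matrixRingAct K k σ⁻¹).comp_algebraMap)

/-- The left (diagonal) action of `Sym(ℕ)` on the scheme of `ℕ × ⋯ × ℕ`-tensors:
on coordinates, `(σ • T)_{i_1,…,i_d} = T_{σ⁻¹(i_1),…,σ⁻¹(i_d)}`. -/
def tensorAct (K : Type u) [CommRing K] (d : ℕ) (σ : Equiv.Perm ℕ) :
    tensorScheme K d ⟶ tensorScheme K d :=
  Over.homMk (Spec.map (CommRingCat.ofHom (tensorRingAct K d σ⁻¹).toRingHom)) (by
    dsimp only [Over.mk_left, Over.mk_hom]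
    rw [← Spec.map_comp, ← CommRingCat.ofHom_comp]
    congr 2
    exact (tensorRingAct K d σ⁻¹).comp_algebraMap)

/-- A morphism of `K`-schemes from matrices to tensors is `Sym(ℕ)`-equivariant. -/
def IsSymEquivariant {K : Type u} [CommRing K] {k d : ℕ}
    (φ : matrixScheme K k ⟶ tensorScheme K d) : Prop :=
  ∀ σ : Equiv.Perm ℕ, matrixAct K k σ ≫ φ = φ ≫ tensorAct K d σ

/-- The closure, in the Zariski topology, of the image of a morphism. -/
def imageClosure {K : Type u} [CommRing K] {k d : ℕ}
    (φ : matrixScheme K k ⟶ tensorScheme K d) : Set (tensorScheme K d).left :=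
  closure (Set.range φ.left)

/-- The `Sym(ℕ)`-orbit of a polynomial in the tensor coordinates. -/
def symOrbit {K : Type u} [CommRing K] {d : ℕ} (f : MvPolynomial (Fin d → ℕ) K) :
    Set (MvPolynomial (Fin d → ℕ) K) :=
  Set.range (fun σ : Equiv.Perm ℕ => tensorRingAct K d σ f)

/-- The closed set of points of the tensor scheme at which all members of `E` vanish. -/
def commonZeros {K : Type u} [CommRing K] {d : ℕ} (E : Set (MvPolynomial (Fin d → ℕ) K)) :
    Set (tensorScheme K d).left :=
  PrimeSpectrum.zeroLocus E

/-- A set of points of the tensor scheme is mapped into itself by every element of `Sym(ℕ)`. -/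
def IsSymStable {K : Type u} [CommRing K] {d : ℕ} (Z : Set (tensorScheme K d).left) : Prop :=
  ∀ σ : Equiv.Perm ℕ, Set.MapsTo (tensorAct K d σ).left Z Z

/-- Descending chains of `Sym(ℕ)`-stable closed subsets of the tensor scheme that are contained
in `Z` stabilise. -/
def IsTopSymNoetherian {K : Type u} [CommRing K] {d : ℕ}
    (Z : Set (tensorScheme K d).left) : Prop :=
  ∀ X : ℕ → Set (tensorScheme K d).left,
    (∀ n, IsClosed (X n)) → (∀ n, IsSymStable (X n)) → (∀ n, X n ⊆ Z) → Antitone X →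
      ∃ N, ∀ n, N ≤ n → X n = X N

end

/-!
A morphism `φ` is dual to an equivariant homomorphism `Φ`. By equivariance the polynomials `Φ (X v)`
have bounded degree, and only the columns with index in `v` occur in them. So in a flattening of the
image tensor whose rows are indexed by one number `i`, every entry is a combination of boundedly
many monomials in the variables of column `i`, with coefficients that do not depend on `i`. Hence
all minors beyond a certain size vanish on the closure of the image.

The locus where such minors vanish is Noetherian up to symmetry, by induction on their sizes. Let
`q A` be one less than the size for the flattening along `A`. At each point, either the minors of
size `q A` that do not vanish all have a row in some small set, or there are `d + 1` of them with
disjoint rows. If the former happens for some `A`, a permutation moves the small set below a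
constant; disregarding the rows below that constant, the bound for `A` drops. Otherwise, on the open
set where the chosen minors do not vanish, Laplace expansion expresses every coordinate through
coordinates whose multi-index has at most one large value: `d + 1` minors suffice because a
multi-index has only `d` entries, and so meets the rows of at most `d` of them. Those coordinates
form finitely many sequences of variables, so Cohen's theorem applies: the ideals of a polynomial
ring over a Noetherian ring in finitely many sequences of variables that are stable under permuting
the columns satisfy the ascending chain condition.
-/

section WellQuasiOrder

lemma wellFoundedGT_subtype_monotone {α L : Type*} {r : α → α → Prop} [IsPreorder α r]
    (hr : WellQuasiOrdered r) [PartialOrder L] [WellFoundedGT L] :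
    WellFoundedGT {F : α → L // ∀ ⦃a b⦄, r a b → F a ≤ F b} := by
  refine ⟨RelEmbedding.wellFounded_iff_isEmpty.2 ⟨fun F => ?_⟩⟩
  have hF : StrictMono F := fun a b hab => F.map_rel_iff.2 hab
  have hlt (n : ℕ) : ∃ a, (F n).1 a < (F (n + 1)).1 a :=
    (Pi.lt_def.1 (hF n.lt_succ_self)).2
  choose a ha using hlt
  obtain ⟨g, hg⟩ := hr.exists_monotone_subseq a
  refine not_strictMono_of_wellFoundedGT (fun n => (F (g n)).1 (a (g n)))
    (strictMono_nat_of_lt_succ fun n => ?_)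
  calc (F (g n)).1 (a (g n)) < (F (g n + 1)).1 (a (g n)) := ha (g n)
    _ ≤ (F (g (n + 1))).1 (a (g n)) := hF.monotone (g.lt_iff_lt.2 n.lt_succ_self) _
    _ ≤ (F (g (n + 1))).1 (a (g (n + 1))) := (F (g (n + 1))).2 (hg _ _ n.le_succ)

end WellQuasiOrder

section LeadingCoefficients

open scoped MonomialOrder

variable {K σ : Type*} [CommRing K] {m : MonomialOrder σ}

variable (m) in
/-- The ideal of leading coefficients of `I` at the exponent `u`: the coefficients at `u` of those
elements of `I` whose degree for the monomial order `m` is at most `u`. -/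
def leadingCoeffIdeal (I : Ideal (MvPolynomial σ K)) (u : σ →₀ ℕ) : Ideal K where
  carrier := {c | ∃ f ∈ I, m.degree f ≼[m] u ∧ f.coeff u = c}
  zero_mem' := ⟨0, I.zero_mem, by simp, by simp⟩
  add_mem' := by
    rintro _ _ ⟨f, hf, hfu, rfl⟩ ⟨g, hg, hgu, rfl⟩
    exact ⟨f + g, I.add_mem hf hg, m.degree_add_le.trans (sup_le hfu hgu),
      MvPolynomial.coeff_add u f g⟩
  smul_mem' := by
    rintro a _ ⟨f, hf, hfu, rfl⟩
    refine ⟨a • f, I.smul_of_tower_mem a hf, m.degree_smul_le.trans hfu, by simp⟩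

lemma leadingCoeffIdeal_mono {I J : Ideal (MvPolynomial σ K)} (h : I ≤ J) (u : σ →₀ ℕ) :
    leadingCoeffIdeal m I u ≤ leadingCoeffIdeal m J u := by
  rintro _ ⟨f, hf, hfu⟩
  exact ⟨f, h hf, hfu⟩

lemma eq_of_leadingCoeffIdeal_eq {I J : Ideal (MvPolynomial σ K)} (h : I ≤ J)
    (hlc : leadingCoeffIdeal m I = leadingCoeffIdeal m J) : I = J := by
  refine le_antisymm h fun f hf => ?_
  induction hu : m.toSyn (m.degree f) using WellFoundedLT.induction generalizing f with
  | ind u ih =>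
    subst hu
    have hlead : f.coeff (m.degree f) ∈ leadingCoeffIdeal m I (m.degree f) :=
      hlc ▸ ⟨f, hf, le_rfl, rfl⟩
    obtain ⟨g, hg, hgle, hgf⟩ := hlead
    suffices f - g ∈ I by simpa using I.add_mem this hg
    by_cases h0 : f - g = 0
    · exact h0 ▸ I.zero_mem
    refine ih _ (lt_of_le_of_ne (m.degree_sub_le.trans (sup_le le_rfl hgle)) fun heq => ?_) (f - g)
      (J.sub_mem hf (h hg)) rfl
    refine h0 ((m.coeff_degree_eq_zero_iff).1 ?_)
    rw [m.toSyn.injective heq, MvPolynomial.coeff_sub, hgf, sub_self]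

lemma leadingCoeffIdeal_le_of_rename {π : σ → σ} (hπ : Function.Injective π)
    (hmono : ∀ a b : σ →₀ ℕ, a ≼[m] b → a.mapDomain π ≼[m] b.mapDomain π)
    {I : Ideal (MvPolynomial σ K)} (hI : ∀ f ∈ I, MvPolynomial.rename π f ∈ I) {u v : σ →₀ ℕ}
    (huv : u.mapDomain π ≤ v) : leadingCoeffIdeal m I u ≤ leadingCoeffIdeal m I v := by
  obtain ⟨a, rfl⟩ := le_iff_exists_add'.1 huv
  rintro _ ⟨f, hf, hfu, rfl⟩
  have hrename : m.degree (MvPolynomial.rename π f) ≼[m] u.mapDomain π := by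
    refine m.degree_le_iff.2 fun b hb => ?_
    obtain ⟨c, rfl, hc⟩ :=
      MvPolynomial.coeff_rename_ne_zero _ _ _ (MvPolynomial.mem_support_iff.1 hb)
    exact hmono c u ((m.le_degree (MvPolynomial.mem_support_iff.2 hc)).trans hfu)
  refine ⟨MvPolynomial.monomial a 1 * MvPolynomial.rename π f, I.mul_mem_left _ (hI f hf), ?_, ?_⟩
  · refine m.degree_mul_le.trans ?_
    rw [map_add, map_add]
    exact add_le_add (m.degree_monomial_le 1) hrename
  · rw [MvPolynomial.coeff_monomial_mul, one_mul, MvPolynomial.coeff_rename_mapDomain _ hπ]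

end LeadingCoefficients

section Cohen

open scoped MonomialOrder

variable {ι : Type*}

/-- Stability of an ideal of `K[x_{i,n}]` under the permutations of the columns `n`. -/
def IsColumnStable {K : Type*} [CommRing K] (I : Ideal (MvPolynomial (ι × ℕ) K)) : Prop :=
  ∀ σ : Equiv.Perm ℕ, ∀ f ∈ I, MvPolynomial.rename (Prod.map id σ) f ∈ I

/-- Divisibility of monomials in the variables `x_{i,n}` up to a strictly increasing relabelling of
the columns `n`. -/
def ColumnEmbeds (u v : ι × ℕ →₀ ℕ) : Prop :=
  ∃ π : ℕ ↪o ℕ, ∀ i n, u (i, n) ≤ v (i, π n)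

instance : IsPreorder (ι × ℕ →₀ ℕ) ColumnEmbeds where
  refl _ := ⟨RelEmbedding.refl _, fun _ _ => le_rfl⟩
  trans _ _ _ := fun ⟨π, hπ⟩ ⟨ρ, hρ⟩ => ⟨π.trans ρ, fun i n => (hπ i n).trans (hρ i (π n))⟩

lemma prodMap_id_injective (π : ℕ ↪o ℕ) : Function.Injective (Prod.map id π : ι × ℕ → ι × ℕ) :=
  Function.injective_id.prodMap π.injective

lemma mapDomain_prodMap_le {u v : ι × ℕ →₀ ℕ} {π : ℕ ↪o ℕ}
    (h : ∀ i n, u (i, n) ≤ v (i, π n)) : u.mapDomain (Prod.map id π) ≤ v := by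
  intro p
  by_cases hp : p ∈ Set.range (Prod.map id π : ι × ℕ → ι × ℕ)
  · obtain ⟨⟨i, n⟩, rfl⟩ := hp
    rw [Finsupp.mapDomain_apply (prodMap_id_injective π)]
    exact h i n
  · rw [Finsupp.mapDomain_of_notMem_range _ _ hp]
    exact zero_le

lemma wellQuasiOrdered_columnEmbeds [Finite ι] :
    WellQuasiOrdered (ColumnEmbeds : (ι × ℕ →₀ ℕ) → (ι × ℕ →₀ ℕ) → Prop) := by
  intro u
  have hN (t : ℕ) : ∃ N, ∀ i n, N ≤ n → u t (i, n) = 0 := by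
    refine ⟨((u t).support.image Prod.snd).sup id + 1, fun i n hn => ?_⟩
    by_contra hne
    have hmem : n ∈ (u t).support.image Prod.snd :=
      Finset.mem_image_of_mem Prod.snd (Finsupp.mem_support_iff.2 hne)
    exact (Finset.le_sup (f := id) hmem).not_gt hn
  choose N hN using hN
  let word (t : ℕ) : List (ι → ℕ) := (List.range (N t)).map fun n i => u t (i, n)
  have higman := Set.PartiallyWellOrderedOn.partiallyWellOrderedOn_sublistForall₂
    (r := ((· ≤ ·) : (ι → ℕ) → (ι → ℕ) → Prop)) (s := Set.univ)
    (Set.isPWO_of_wellQuasiOrderedLE _)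
  obtain ⟨s, t, hst, hword⟩ := higman fun t => ⟨word t, fun _ _ => Set.mem_univ _⟩
  refine ⟨s, t, hst, ?_⟩
  obtain ⟨l, hl, hsub⟩ := List.sublistForall₂_iff.1 hword
  obtain ⟨π, hπ⟩ := List.sublist_iff_exists_orderEmbedding_getElem?_eq.1 hsub
  refine ⟨π, fun i n => ?_⟩
  by_cases hn : N s ≤ n
  · exact (hN s i n hn).trans_le zero_le
  have hlen : n < l.length := by
    have : l.length = N s := by simpa [word] using hl.length_eq.symm
    lia
  have hle : u s (i, n) ≤ l[n] i := by
    simpa [word] using (List.forall₂_iff_get.1 hl).2 n (by simpa [word] using hn) hlen i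
  have hget : (word t)[π n]? = some l[n] := by rw [← hπ n, List.getElem?_eq_getElem hlen]
  obtain ⟨hlt, heq⟩ := List.getElem?_eq_some_iff.1 hget
  rw [← heq] at hle
  simpa [word] using hle

/-- The colexicographic order of monomials in the variables `x_{i,n}`, where later columns weigh
more. -/
noncomputable def columnOrder (ι : Type*) [LinearOrder ι] [WellFoundedLT ι] :
    MonomialOrder (ι × ℕ) where
  syn := Colex ((ℕ ×ₗ ι) →₀ ℕ)
  toSyn := (Finsupp.domCongr ((Equiv.prodComm ι ℕ).trans toLex)).trans
    { toEquiv := toColex, map_add' := toColex_add }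
  toSyn_monotone := fun _ _ h => Finsupp.toColex_monotone fun p : ℕ ×ₗ ι => h (ofLex p).swap

lemma columnOrder_lt_iff [LinearOrder ι] [WellFoundedLT ι] {u v : ι × ℕ →₀ ℕ} :
    u ≺[columnOrder ι] v ↔ ∃ p : ι × ℕ,
      (∀ q : ι × ℕ, toLex p.swap < toLex q.swap → u q = v q) ∧ u p < v p := by
  refine (Finsupp.Colex.lt_iff (α := ℕ ×ₗ ι) (N := ℕ)).trans ⟨?_, ?_⟩
  · rintro ⟨p, hp, hlt⟩
    exact ⟨(ofLex p).swap, fun q hq => hp (toLex q.swap) hq, hlt⟩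
  · rintro ⟨p, hp, hlt⟩
    exact ⟨toLex p.swap, fun q hq => hp (ofLex q).swap hq, hlt⟩

lemma columnOrder_mapDomain_lt [LinearOrder ι] [WellFoundedLT ι] (π : ℕ ↪o ℕ) {u v : ι × ℕ →₀ ℕ}
    (h : u ≺[columnOrder ι] v) :
    u.mapDomain (Prod.map id π) ≺[columnOrder ι] v.mapDomain (Prod.map id π) := by
  obtain ⟨⟨i, n⟩, heq, hlt⟩ := columnOrder_lt_iff.1 h
  refine columnOrder_lt_iff.2 ⟨Prod.map id π (i, n), fun q hq => ?_, ?_⟩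
  · by_cases hr : q ∈ Set.range (Prod.map id π : ι × ℕ → ι × ℕ)
    · obtain ⟨q, rfl⟩ := hr
      simp only [Finsupp.mapDomain_apply (prodMap_id_injective π)]
      refine heq q ?_
      simpa [Prod.Lex.toLex_lt_toLex] using hq
    · simp only [Finsupp.mapDomain_of_notMem_range _ _ hr]
  · simpa only [Finsupp.mapDomain_apply (prodMap_id_injective π)] using hlt

lemma columnOrder_mapDomain_le [LinearOrder ι] [WellFoundedLT ι] (π : ℕ ↪o ℕ) (u v : ι × ℕ →₀ ℕ)
    (h : u ≼[columnOrder ι] v) :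
    u.mapDomain (Prod.map id π) ≼[columnOrder ι] v.mapDomain (Prod.map id π) := by
  rcases h.lt_or_eq with h | h
  · exact (columnOrder_mapDomain_lt π h).le
  · exact ((columnOrder ι).toSyn.injective h ▸ le_rfl)

lemma rename_eq_of_eqOn_vars {K σ τ : Type*} [CommRing K] {f g : σ → τ} {p : MvPolynomial σ K}
    (h : ∀ i ∈ p.vars, f i = g i) : MvPolynomial.rename f p = MvPolynomial.rename g p := by
  refine MvPolynomial.hom_congr_vars (f₁ := (MvPolynomial.rename f : _ →ₐ[K] _).toRingHom)
    (f₂ := (MvPolynomial.rename g : _ →ₐ[K] _).toRingHom) ?_ (fun i hi _ => ?_) rfl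
  · ext; simp
  · simp [h i hi]

lemma exists_perm_eqOn {π : ℕ → ℕ} (hπ : Function.Injective π) (s : Finset ℕ) :
    ∃ σ : Equiv.Perm ℕ, ∀ n ∈ s, σ n = π n := by
  obtain ⟨σ, hσ⟩ := Equiv.Perm.exists_extending_pair (fun n : s => (n : ℕ)) (fun n : s => π n)
    Subtype.val_injective (hπ.comp Subtype.val_injective)
  exact ⟨σ, fun n hn => hσ ⟨n, hn⟩⟩

lemma IsColumnStable.rename_mem {K : Type*} [CommRing K] {I : Ideal (MvPolynomial (ι × ℕ) K)}
    (hI : IsColumnStable I) {π : ℕ → ℕ} (hπ : Function.Injective π)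
    {f : MvPolynomial (ι × ℕ) K} (hf : f ∈ I) :
    MvPolynomial.rename (Prod.map id π) f ∈ I := by
  classical
  obtain ⟨σ, hσ⟩ := exists_perm_eqOn hπ (f.vars.image Prod.snd)
  have heq : ∀ p ∈ f.vars, Prod.map id σ p = Prod.map id π p := fun p hp =>
    Prod.ext rfl (hσ p.2 (Finset.mem_image_of_mem _ hp))
  exact rename_eq_of_eqOn_vars heq ▸ hI σ f hf

/-- **Cohen's theorem**. A column-stable ideal is determined, among those above it, by its ideals of
leading coefficients, which increase along `ColumnEmbeds`, a well-quasi-order by Higman's lemma. -/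
theorem wellFoundedGT_isColumnStable {K : Type*} [CommRing K] [IsNoetherianRing K] [Finite ι] :
    WellFoundedGT {I : Ideal (MvPolynomial (ι × ℕ) K) // IsColumnStable I} := by
  cases nonempty_fintype ι
  let _ : LinearOrder ι := LinearOrder.lift' (Fintype.equivFin ι) (Fintype.equivFin ι).injective
  have := wellFoundedGT_subtype_monotone (L := Ideal K) (wellQuasiOrdered_columnEmbeds (ι := ι))
  let lc (I : {I : Ideal (MvPolynomial (ι × ℕ) K) // IsColumnStable I}) :
      {F : (ι × ℕ →₀ ℕ) → Ideal K // ∀ ⦃u v⦄, ColumnEmbeds u v → F u ≤ F v} :=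
    ⟨leadingCoeffIdeal (columnOrder ι) I.1, fun _ _ ⟨π, hπ⟩ =>
      leadingCoeffIdeal_le_of_rename (prodMap_id_injective π) (columnOrder_mapDomain_le π)
        (fun _ => I.2.rename_mem π.injective) (mapDomain_prodMap_le hπ)⟩
  have hlc : StrictMono lc := fun I J hIJ =>
    lt_of_le_of_ne (leadingCoeffIdeal_mono hIJ.le) fun heq =>
      hIJ.ne (Subtype.ext (eq_of_leadingCoeffIdeal_eq hIJ.le (congrArg Subtype.val heq)))
  exact hlc.wellFoundedGT

end Cohen

section NoetherianUpTo

variable {G X : Type*} [Group G] [MulAction G X]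

/-- The elements of the subgroup `H` map the set `C` into itself. -/
def IsStableUnder (H : Subgroup G) (C : Set X) : Prop :=
  ∀ g ∈ H, ∀ x ∈ C, g • x ∈ C

lemma IsStableUnder.anti {H H' : Subgroup G} {C : Set X} (hC : IsStableUnder H' C) (h : H ≤ H') :
    IsStableUnder H C :=
  fun g hg => hC g (h hg)

lemma IsStableUnder.inter {H : Subgroup G} {C D : Set X} (hC : IsStableUnder H C)
    (hD : IsStableUnder H D) : IsStableUnder H (C ∩ D) :=
  fun g hg x hx => ⟨hC g hg x hx.1, hD g hg x hx.2⟩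

lemma IsStableUnder.sInter {H : Subgroup G} {𝒞 : Set (Set X)} (h : ∀ C ∈ 𝒞, IsStableUnder H C) :
    IsStableUnder H (⋂₀ 𝒞) :=
  fun g hg x hx C hC => h C hC g hg x (hx C hC)

/-- The subset `Y` of the topological space `X` is Noetherian up to the action of the subgroup `H`:
on `Y`, the intersection of any family of `H`-stable closed subsets of `X` is already cut out by
finitely many members of the family. It is not assumed that `Y` itself is closed or stable. -/
def IsNoetherianUpTo [TopologicalSpace X] (H : Subgroup G) (Y : Set X) : Prop :=
  ∀ 𝒞 : Set (Set X), (∀ C ∈ 𝒞, IsClosed C ∧ IsStableUnder H C) →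
    ∃ t ⊆ 𝒞, t.Finite ∧ ⋂₀ t ∩ Y ⊆ ⋂₀ 𝒞

variable [TopologicalSpace X] {H H' : Subgroup G} {Y Y' : Set X}

lemma IsNoetherianUpTo.mono (hY : IsNoetherianUpTo H Y) (hH : H ≤ H') (hY' : Y' ⊆ Y) :
    IsNoetherianUpTo H' Y' := by
  intro 𝒞 h𝒞
  obtain ⟨t, ht, hfin, hsub⟩ := hY 𝒞 fun C hC => ⟨(h𝒞 C hC).1, (h𝒞 C hC).2.anti hH⟩
  exact ⟨t, ht, hfin, (Set.inter_subset_inter_right _ hY').trans hsub⟩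

lemma IsNoetherianUpTo.of_cover {ι : Type*} [Finite ι] {U : ι → Set X}
    (hU : ∀ i, IsNoetherianUpTo H (U i)) (hcover : ∀ x ∈ Y, ∃ i, ∃ g ∈ H, g • x ∈ U i) :
    IsNoetherianUpTo H Y := by
  intro 𝒞 h𝒞
  choose t ht hfin hsub using fun i => hU i 𝒞 h𝒞
  refine ⟨⋃ i, t i, Set.iUnion_subset ht, Set.finite_iUnion hfin, fun x ⟨hxt, hxY⟩ C hC => ?_⟩
  obtain ⟨i, g, hg, hgx⟩ := hcover x hxY
  have hmem : g • x ∈ ⋂₀ t i := fun D hD =>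
    (h𝒞 D (ht i hD)).2 g hg x (hxt D (Set.mem_iUnion_of_mem i hD))
  have := (h𝒞 C hC).2 g⁻¹ (H.inv_mem hg) _ (hsub i ⟨hmem, hgx⟩ C hC)
  rwa [inv_smul_smul] at this

lemma IsNoetherianUpTo.exists_eq_of_antitone (hY : IsNoetherianUpTo H Y) {Z : ℕ → Set X}
    (hclosed : ∀ n, IsClosed (Z n)) (hstable : ∀ n, IsStableUnder H (Z n)) (hsub : ∀ n, Z n ⊆ Y)
    (hanti : Antitone Z) : ∃ N, ∀ n, N ≤ n → Z n = Z N := by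
  obtain ⟨t, ht, hfin, hcut⟩ := hY (Set.range Z) (by
    rintro _ ⟨n, rfl⟩
    exact ⟨hclosed n, hstable n⟩)
  obtain ⟨s, rfl⟩ := Set.subset_range_iff_exists_image_eq.1 ht
  obtain ⟨s', -, hs', heq⟩ := Set.exists_subset_image_finite_and.1 ⟨_, subset_rfl, hfin, rfl⟩
  obtain ⟨N, hN⟩ := hs'.bddAbove
  refine ⟨N, fun n hn => (hanti hn).antisymm fun x hx => hcut ⟨?_, hsub N hx⟩ _ ⟨n, rfl⟩⟩
  rw [heq]
  rintro _ ⟨j, hj, rfl⟩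
  exact hanti (hN hj) hx

end NoetherianUpTo

section FixBelow

/-- The permutations of `ℕ` that fix all numbers less than `n`. -/
def fixBelow (n : ℕ) : Subgroup (Equiv.Perm ℕ) :=
  fixingSubgroup (Equiv.Perm ℕ) (Set.Iio n)

lemma mem_fixBelow {n : ℕ} {σ : Equiv.Perm ℕ} : σ ∈ fixBelow n ↔ ∀ i < n, σ i = i :=
  mem_fixingSubgroup_iff _

lemma fixBelow_antitone : Antitone fixBelow :=
  fun _ _ h => fixingSubgroup_antitone _ _ (Set.Iio_subset_Iio h)

lemma le_apply_of_mem_fixBelow {n i : ℕ} {σ : Equiv.Perm ℕ} (hσ : σ ∈ fixBelow n) (hi : n ≤ i) :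
    n ≤ σ i := by
  by_contra! hlt
  exact hi.not_gt (σ.injective (mem_fixBelow.1 hσ _ hlt) ▸ hlt)

lemma exists_mem_fixBelow_map_lt (n : ℕ) (s : Finset ℕ) :
    ∃ σ ∈ fixBelow n, ∀ i ∈ s, σ i < n + s.card := by
  let t := s.filter (n ≤ ·)
  have hval : Function.Injective (Sum.elim Fin.val Subtype.val : Fin n ⊕ t → ℕ) :=
    Fin.val_injective.sumElim Subtype.val_injective fun i j =>
      (i.2.trans_le (Finset.mem_filter.1 j.2).2).ne
  have hcount : Function.Injective
      (Sum.elim Fin.val (fun j => n + t.equivFin j) : Fin n ⊕ t → ℕ) :=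
    Fin.val_injective.sumElim
      (fun _ _ h => t.equivFin.injective (Fin.ext (Nat.add_left_cancel h)))
      fun i _ => (i.2.trans_le (Nat.le_add_right _ _)).ne
  obtain ⟨σ, hσ⟩ := Equiv.Perm.exists_extending_pair _ _ hval hcount
  have hfix : ∀ i < n, σ i = i := fun i hi => hσ (Sum.inl ⟨i, hi⟩)
  refine ⟨σ, mem_fixBelow.2 hfix, fun i hi => ?_⟩
  rcases lt_or_ge i n with hin | hni
  · rw [hfix i hin]
    lia
  · have hcard : t.card ≤ s.card := Finset.card_filter_le _ _
    have hσi : σ i = n + t.equivFin ⟨i, Finset.mem_filter.2 ⟨hi, hni⟩⟩ := hσ (Sum.inr ⟨i, _⟩)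
    rw [hσi]
    lia

lemma viaEmbedding_addLeft_mem_fixBelow (m : ℕ) (σ : Equiv.Perm ℕ) :
    σ.viaEmbedding (addLeftEmbedding m) ∈ fixBelow m :=
  mem_fixBelow.2 fun i hi => Equiv.Perm.viaEmbedding_apply_of_notMem _ _ _ (by
    rintro ⟨j, rfl⟩
    exact hi.not_ge (Nat.le_add_right m j))

end FixBelow

section Minors

variable {K : Type u} [CommRing K] {d : ℕ}

lemma tensorRingAct_one : tensorRingAct K d 1 = AlgHom.id K _ :=
  MvPolynomial.rename_id

lemma tensorRingAct_mul (σ τ : Equiv.Perm ℕ) :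
    tensorRingAct K d (σ * τ) = (tensorRingAct K d σ).comp (tensorRingAct K d τ) :=
  MvPolynomial.algHom_ext fun v => by simp [tensorRingAct]

/-- The action of `Sym(ℕ)` on the points of the tensor scheme: `σ` acts as `(tensorAct K d σ).left`.
-/
noncomputable instance : MulAction (Equiv.Perm ℕ) (PrimeSpectrum (MvPolynomial (Fin d → ℕ) K)) where
  smul σ := PrimeSpectrum.comap (tensorRingAct K d σ⁻¹).toRingHom
  one_smul p := by
    change PrimeSpectrum.comap (tensorRingAct K d 1⁻¹).toRingHom p = p
    rw [inv_one, tensorRingAct_one]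
    rfl
  mul_smul σ τ p := by
    change PrimeSpectrum.comap (tensorRingAct K d (σ * τ)⁻¹).toRingHom p = _
    rw [mul_inv_rev, tensorRingAct_mul]
    rfl

lemma mem_smul_iff {σ : Equiv.Perm ℕ} {p : PrimeSpectrum (MvPolynomial (Fin d → ℕ) K)}
    {f : MvPolynomial (Fin d → ℕ) K} :
    f ∈ (σ • p).asIdeal ↔ tensorRingAct K d σ⁻¹ f ∈ p.asIdeal :=
  Iff.rfl

lemma tensorRingAct_mem_smul_iff {σ : Equiv.Perm ℕ}
    {p : PrimeSpectrum (MvPolynomial (Fin d → ℕ) K)} {f : MvPolynomial (Fin d → ℕ) K} :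
    tensorRingAct K d σ f ∈ (σ • p).asIdeal ↔ f ∈ p.asIdeal := by
  rw [mem_smul_iff, ← AlgHom.comp_apply, ← tensorRingAct_mul, inv_mul_cancel, tensorRingAct_one,
    AlgHom.id_apply]

/-- The multi-index with entries `i` at the positions in `A` and entries of `w` elsewhere. -/
def slot (A : Finset (Fin d)) (i : ℕ) (w : Fin d → ℕ) : Fin d → ℕ :=
  fun l => if l ∈ A then i else w l

lemma comp_slot (f : ℕ → ℕ) (A : Finset (Fin d)) (i : ℕ) (w : Fin d → ℕ) :
    f ∘ slot A i w = slot A (f i) (f ∘ w) :=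
  funext fun _ => apply_ite f _ _ _

lemma slot_eq_self {A : Finset (Fin d)} {i : ℕ} {w : Fin d → ℕ} (h : ∀ l ∈ A, w l = i) :
    slot A i w = w := by
  funext l
  unfold slot
  split_ifs with hl
  · exact (h l hl).symm
  · rfl

/-- A choice of `r` rows and columns in the flattening of the generic tensor along `A`. Its rows
are indexed by a single number, which is placed at all positions in `A`; the positions outside `A`
are taken from the column index, whose entries in `A` are irrelevant. -/
structure MinorIndex (A : Finset (Fin d)) (r : ℕ) where
  row : Fin r → ℕ
  col : Fin r → Fin d → ℕ

namespace MinorIndex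

variable {A : Finset (Fin d)} {r : ℕ}

variable (K) in
/-- The submatrix of the flattening of the generic tensor with the rows and columns of `μ`. -/
noncomputable def matrix (μ : MinorIndex A r) :
    Matrix (Fin r) (Fin r) (MvPolynomial (Fin d → ℕ) K) :=
  Matrix.of fun a b => MvPolynomial.X (slot A (μ.row a) (μ.col b))

variable (K) in
/-- The minor of the flattening of the generic tensor with the rows and columns of `μ`. -/
noncomputable def minor (μ : MinorIndex A r) : MvPolynomial (Fin d → ℕ) K :=
  (μ.matrix K).det

/-- The set of row indices of a minor. -/
def rows (μ : MinorIndex A r) : Finset ℕ :=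
  Finset.univ.image μ.row

/-- The set of all numbers that occur in the row and column indices of a minor. -/
def indices (μ : MinorIndex A r) : Finset ℕ :=
  μ.rows ∪ Finset.univ.image fun bl : Fin r × Fin d => μ.col bl.1 bl.2

/-- The row indices of `μ` are at least `n` and do not occur in the column indices. -/
structure Admissible (n : ℕ) (μ : MinorIndex A r) : Prop where
  le_row : ∀ a, n ≤ μ.row a
  col_ne_row : ∀ a b, ∀ l ∉ A, μ.col b l ≠ μ.row a

instance : MulAction (Equiv.Perm ℕ) (MinorIndex A r) where
  smul σ μ := ⟨σ ∘ μ.row, fun b => σ ∘ μ.col b⟩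
  one_smul _ := rfl
  mul_smul _ _ _ := rfl

lemma row_mem_rows (μ : MinorIndex A r) (a : Fin r) : μ.row a ∈ μ.rows :=
  Finset.mem_image_of_mem _ (Finset.mem_univ a)

lemma row_mem_indices (μ : MinorIndex A r) (a : Fin r) : μ.row a ∈ μ.indices :=
  Finset.mem_union_left _ (μ.row_mem_rows a)

lemma col_mem_indices (μ : MinorIndex A r) (b : Fin r) (l : Fin d) : μ.col b l ∈ μ.indices :=
  Finset.mem_union_right _ (Finset.mem_image_of_mem (fun bl : Fin r × Fin d => μ.col bl.1 bl.2)
    (Finset.mem_univ (b, l)))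

lemma card_rows_le (μ : MinorIndex A r) : μ.rows.card ≤ r :=
  Finset.card_image_le.trans (Finset.card_fin r).le

lemma card_indices_le (μ : MinorIndex A r) : μ.indices.card ≤ r * (d + 1) :=
  calc μ.indices.card ≤ r + r * d :=
        (Finset.card_union_le _ _).trans
          (add_le_add μ.card_rows_le (Finset.card_image_le.trans (by simp)))
    _ = r * (d + 1) := by ring

lemma finite_setOf_indices_subset (A : Finset (Fin d)) (r : ℕ) (s : Finset ℕ) :
    {μ : MinorIndex A r | μ.indices ⊆ s}.Finite := by
  refine (Set.finite_range fun x : (Fin r → s) × (Fin r → Fin d → s) =>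
    (⟨fun a => x.1 a, fun b l => x.2 b l⟩ : MinorIndex A r)).subset fun μ hμ => ?_
  exact ⟨(fun a => ⟨μ.row a, hμ (μ.row_mem_indices a)⟩,
    fun b l => ⟨μ.col b l, hμ (μ.col_mem_indices b l)⟩), rfl⟩

lemma indices_smul (σ : Equiv.Perm ℕ) (μ : MinorIndex A r) :
    (σ • μ).indices = μ.indices.image σ := by
  simp only [indices, rows, Finset.image_union, Finset.image_image]
  rfl

lemma rows_smul (σ : Equiv.Perm ℕ) (μ : MinorIndex A r) : (σ • μ).rows = μ.rows.image σ := by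
  simp only [rows, Finset.image_image]
  rfl

lemma tensorRingAct_minor (σ : Equiv.Perm ℕ) (μ : MinorIndex A r) :
    tensorRingAct K d σ (μ.minor K) = (σ • μ).minor K := by
  rw [minor, AlgHom.map_det]
  congr 1
  ext1 a b
  exact (MvPolynomial.rename_X _ _).trans (congrArg _ (comp_slot σ A _ _))

lemma minor_smul_mem_smul_iff {σ : Equiv.Perm ℕ} {μ : MinorIndex A r}
    {p : PrimeSpectrum (MvPolynomial (Fin d → ℕ) K)} :
    (σ • μ).minor K ∈ (σ • p).asIdeal ↔ μ.minor K ∈ p.asIdeal := by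
  rw [← tensorRingAct_minor, tensorRingAct_mem_smul_iff]

lemma Admissible.mono {n n' : ℕ} {μ : MinorIndex A r} (hμ : μ.Admissible n') (h : n ≤ n') :
    μ.Admissible n :=
  ⟨fun a => h.trans (hμ.le_row a), hμ.col_ne_row⟩

lemma Admissible.smul {n : ℕ} {μ : MinorIndex A r} (hμ : μ.Admissible n) {σ : Equiv.Perm ℕ}
    (hσ : σ ∈ fixBelow n) : (σ • μ).Admissible n where
  le_row a := le_apply_of_mem_fixBelow hσ (hμ.le_row a)
  col_ne_row a b l hl := σ.injective.ne (hμ.col_ne_row a b l hl)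

end MinorIndex

variable (K) in
/-- The locus in the tensor space where, for each `A`, all admissible minors of size `r A` of the
flattening along `A` vanish. -/
def rankLocus (n : ℕ) (r : Finset (Fin d) → ℕ) :
    Set (PrimeSpectrum (MvPolynomial (Fin d → ℕ) K)) :=
  {p | ∀ A, ∀ μ : MinorIndex A (r A), μ.Admissible n → μ.minor K ∈ p.asIdeal}

lemma isClosed_rankLocus (n : ℕ) (r : Finset (Fin d) → ℕ) : IsClosed (rankLocus K n r) := by
  simp only [rankLocus, Set.ofPred_forall]
  refine isClosed_iInter fun A => isClosed_iInter fun μ => isClosed_iInter fun _ => ?_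
  convert PrimeSpectrum.isClosed_zeroLocus {μ.minor K} using 1
  ext p
  simp [PrimeSpectrum.mem_zeroLocus]

lemma isStableUnder_rankLocus (n : ℕ) (r : Finset (Fin d) → ℕ) :
    IsStableUnder (fixBelow n) (rankLocus K n r) := by
  intro σ hσ p hp A μ hμ
  rw [mem_smul_iff, MinorIndex.tensorRingAct_minor]
  exact hp A _ (hμ.smul (inv_mem hσ))

lemma rankLocus_eq_empty (n : ℕ) {r : Finset (Fin d) → ℕ} {A : Finset (Fin d)} (hA : r A = 0) :
    rankLocus K n r = ∅ := by
  refine Set.eq_empty_of_forall_notMem fun p hp => p.isPrime.ne_top ?_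
  have : IsEmpty (Fin (r A)) := by rw [hA]; infer_instance
  have hone := hp A ⟨isEmptyElim, isEmptyElim⟩ ⟨isEmptyElim, isEmptyElim⟩
  rw [MinorIndex.minor, Matrix.det_isEmpty] at hone
  exact (Ideal.eq_top_iff_one _).2 hone

end Minors

section WideCoordinates

variable {K : Type u} [CommRing K] {d : ℕ}

/-- The multi-indices with at most one value outside `{0, …, m - 1}`: in the multi-index attached to
`(e, j)`, the positions at which `e` is `none` carry the number `m + j`. -/
def wideIndex (d m : ℕ) (p : (Fin d → Option (Fin m)) × ℕ) : Fin d → ℕ :=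
  fun l => (p.1 l).elim (m + p.2) Fin.val

lemma mem_range_wideIndex {m i : ℕ} {v : Fin d → ℕ} (hv : ∀ l, v l < m ∨ v l = i) :
    v ∈ Set.range (wideIndex d m) := by
  refine ⟨(fun l => if h : v l < m then some ⟨v l, h⟩ else none, i - m), funext fun l => ?_⟩
  by_cases h : v l < m
  · simp [wideIndex, h]
  · have hl : v l = i := (hv l).resolve_left h
    simp only [wideIndex, h, dite_false, Option.elim_none]
    lia

variable (K d) in
/-- The ring homomorphism that includes the coordinates with multi-indices in the range of
`wideIndex` into the coordinate ring of the tensor space. -/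
noncomputable def wideParam (m : ℕ) :
    MvPolynomial ((Fin d → Option (Fin m)) × ℕ) K →ₐ[K] MvPolynomial (Fin d → ℕ) K :=
  MvPolynomial.rename (wideIndex d m)

lemma X_mem_range_wideParam {m i : ℕ} {v : Fin d → ℕ} (hv : ∀ l, v l < m ∨ v l = i) :
    MvPolynomial.X v ∈ (wideParam K d m).range := by
  obtain ⟨p, rfl⟩ := mem_range_wideIndex hv
  exact ⟨MvPolynomial.X p, MvPolynomial.rename_X _ _⟩

lemma wideParam_rename (m : ℕ) (σ : Equiv.Perm ℕ)
    (f : MvPolynomial ((Fin d → Option (Fin m)) × ℕ) K) :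
    wideParam K d m (MvPolynomial.rename (Prod.map id σ) f) =
      tensorRingAct K d (σ.viaEmbedding (addLeftEmbedding m)) (wideParam K d m f) := by
  rw [wideParam, tensorRingAct, MvPolynomial.rename_rename, MvPolynomial.rename_rename]
  congr 2
  funext p l
  cases h : p.1 l with
  | none =>
    simpa [wideIndex, h] using (σ.viaEmbedding_apply (addLeftEmbedding m) p.2).symm
  | some j =>
    simpa [wideIndex, h] using
      (mem_fixBelow.1 (viaEmbedding_addLeft_mem_fixBelow m σ) j j.is_lt).symm

lemma isColumnStable_comap_vanishingIdeal {m : ℕ}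
    {C : Set (PrimeSpectrum (MvPolynomial (Fin d → ℕ) K))} (hC : IsStableUnder (fixBelow m) C) :
    IsColumnStable ((PrimeSpectrum.vanishingIdeal C).comap (wideParam K d m)) := by
  intro σ f hf
  rw [Ideal.mem_comap, PrimeSpectrum.mem_vanishingIdeal] at hf ⊢
  intro p hp
  rw [wideParam_rename, ← inv_inv (σ.viaEmbedding _), ← mem_smul_iff]
  exact hf _ (hC _ (inv_mem (viaEmbedding_addLeft_mem_fixBelow m σ)) p hp)

end WideCoordinates

section Saturation

variable {K B : Type*} [CommRing K] [CommRing B] [Algebra K B]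

/-- The elements that agree, modulo the ideal `V` and up to powers of `h`, with an element of the
subalgebra `P`. -/
def saturation (V : Ideal B) (P : Subalgebra K B) (h : B) (hP : h ∈ P) : Subalgebra K B where
  carrier := {f | ∃ e : ℕ, ∃ g ∈ P, h ^ e * f - g ∈ V}
  mul_mem' := by
    rintro f₁ f₂ ⟨e₁, g₁, hg₁, h₁⟩ ⟨e₂, g₂, hg₂, h₂⟩
    refine ⟨e₁ + e₂, g₁ * g₂, P.mul_mem hg₁ hg₂, ?_⟩
    convert V.add_mem (V.mul_mem_left (h ^ e₂ * f₂) h₁) (V.mul_mem_left g₁ h₂) using 1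
    ring
  add_mem' := by
    rintro f₁ f₂ ⟨e₁, g₁, hg₁, h₁⟩ ⟨e₂, g₂, hg₂, h₂⟩
    refine ⟨e₁ + e₂, h ^ e₂ * g₁ + h ^ e₁ * g₂,
      P.add_mem (P.mul_mem (P.pow_mem hP _) hg₁) (P.mul_mem (P.pow_mem hP _) hg₂), ?_⟩
    convert V.add_mem (V.mul_mem_left (h ^ e₂) h₁) (V.mul_mem_left (h ^ e₁) h₂) using 1
    ring
  algebraMap_mem' := fun a => ⟨0, algebraMap K B a, P.algebraMap_mem a, by simp⟩

variable {V : Ideal B} {P : Subalgebra K B} {h : B} {hP : h ∈ P}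

lemma le_saturation : P ≤ saturation V P h hP :=
  fun g hg => ⟨0, g, hg, by simp⟩

lemma mem_saturation_of_mem_ideal {f : B} (hf : f ∈ V) : f ∈ saturation V P h hP :=
  ⟨0, 0, P.zero_mem, by simpa using hf⟩

lemma mem_saturation_of_mul_mem {f g c : B} (hc : c ∈ P) (hcg : c * g = h)
    (hf : g * f ∈ saturation V P h hP) : f ∈ saturation V P h hP := by
  obtain ⟨e, b, hb, hV⟩ := hf
  refine ⟨e + 1, c * b, P.mul_mem hc hb, ?_⟩
  convert V.mul_mem_left c hV using 1
  rw [pow_succ]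
  nth_rewrite 2 [← hcg]
  ring

lemma inter_subset_of_comap_vanishingIdeal_le {R : Type*} [CommRing R] {w : R →+* B}
    {Y C D : Set (PrimeSpectrum B)}
    (hY : ∀ f, ∃ e : ℕ, ∃ g, h ^ e * f - w g ∈ PrimeSpectrum.vanishingIdeal Y) (hC : IsClosed C)
    (hCY : C ⊆ Y) (hDY : D ⊆ Y) (hle : (PrimeSpectrum.vanishingIdeal C).comap w ≤
      (PrimeSpectrum.vanishingIdeal D).comap w) :
    D ∩ {p | h ∉ p.asIdeal} ⊆ C := by
  rintro p ⟨hpD, hhp⟩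
  rw [← hC.closure_eq, ← PrimeSpectrum.zeroLocus_vanishingIdeal_eq_closure,
    PrimeSpectrum.mem_zeroLocus]
  intro f hf
  obtain ⟨e, g, hg⟩ := hY f
  have hgC : w g ∈ PrimeSpectrum.vanishingIdeal C :=
    (Submodule.sub_mem_iff_right _ (Ideal.mul_mem_left _ _ hf)).1
      (PrimeSpectrum.vanishingIdeal_anti_mono hCY hg)
  have hgp : w g ∈ p.asIdeal := (PrimeSpectrum.mem_vanishingIdeal _ _).1 (hle hgC) p hpD
  have hfp : h ^ e * f ∈ p.asIdeal :=
    (Submodule.sub_mem_iff_left _ hgp).1 ((PrimeSpectrum.mem_vanishingIdeal _ _).1 hg p (hDY hpD))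
  exact (p.isPrime.mem_or_mem hfp).resolve_left fun hpow => hhp (p.isPrime.mem_of_pow_mem e hpow)

end Saturation

section Laplace

variable {B σ : Type*} [CommRing B] [SetLike σ B] [SubringClass σ B] {s : σ}

lemma det_mem_of_forall_mem {n : Type*} [Fintype n] [DecidableEq n] {M : Matrix n n B}
    (h : ∀ i j, M i j ∈ s) : M.det ∈ s := by
  rw [Matrix.det_apply']
  exact sum_mem fun τ _ => mul_mem (intCast_mem s _) (prod_mem fun i _ => h _ _)

lemma mul_det_submatrix_succ_mem {r : ℕ} {M : Matrix (Fin (r + 1)) (Fin (r + 1)) B}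
    (hdet : M.det ∈ s) (hfirst : ∀ a : Fin r, M a.succ 0 ∈ s)
    (hrest : ∀ a, ∀ b : Fin r, M a b.succ ∈ s) :
    M 0 0 * (M.submatrix Fin.succ Fin.succ).det ∈ s := by
  rw [Matrix.det_succ_column_zero, Fin.sum_univ_succ] at hdet
  have hsum : ∑ a : Fin r, (-1) ^ (a.succ : ℕ) * M a.succ 0 *
      (M.submatrix a.succ.succAbove Fin.succ).det ∈ s :=
    sum_mem fun a _ => mul_mem (mul_mem (pow_mem (neg_mem (one_mem s)) _) (hfirst a))
      (det_mem_of_forall_mem fun _ _ => hrest _ _)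
  simpa using (add_mem_cancel_right hsum).1 hdet

end Laplace

section GoodFamilies

variable {K : Type u} [CommRing K] {d : ℕ}

/-- The minor obtained from `μ` by adding a first row with index `i` and a first column with index
`v`. -/
def MinorIndex.cons {A : Finset (Fin d)} {r : ℕ} (i : ℕ) (v : Fin d → ℕ) (μ : MinorIndex A r) :
    MinorIndex A (r + 1) :=
  ⟨Fin.cons i μ.row, Fin.cons v μ.col⟩

lemma MinorIndex.Admissible.cons {A : Finset (Fin d)} {r n i : ℕ} {v : Fin d → ℕ}
    {μ : MinorIndex A r} (hμ : μ.Admissible n) (hi : n ≤ i) (hvi : ∀ l ∉ A, v l ≠ i)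
    (hcol : ∀ b, ∀ l, μ.col b l ≠ i) (hrow : ∀ l, v l ∉ μ.rows) :
    (μ.cons i v).Admissible n where
  le_row := Fin.cases hi hμ.le_row
  col_ne_row := Fin.cases (Fin.cases hvi fun b l _ => hcol b l) fun a =>
    Fin.cases (fun l _ (h : v l = μ.row a) => hrow l (h ▸ μ.row_mem_rows a)) (hμ.col_ne_row a)

/-- The values of the multi-index `v` that are at least `m`. -/
def largeValues (m : ℕ) (v : Fin d → ℕ) : Finset ℕ :=
  (Finset.univ.image v).filter (m ≤ ·)

lemma mem_largeValues {m i : ℕ} {v : Fin d → ℕ} :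
    i ∈ largeValues m v ↔ (∃ l, v l = i) ∧ m ≤ i := by
  simp [largeValues]

lemma largeValues_slot_ssubset {m i j : ℕ} {v : Fin d → ℕ} (hi : i ∈ largeValues m v)
    (hj : j < m) : largeValues m (slot {l | v l = i} j v) ⊂ largeValues m v := by
  have hslot : ∀ i' ∈ largeValues m (slot {l | v l = i} j v), ∃ l, v l = i' ∧ i' ≠ i := by
    intro i' hi'
    obtain ⟨⟨l, hl⟩, hmi'⟩ := mem_largeValues.1 hi'
    by_cases hvl : v l = i
    · simp only [slot, Finset.mem_filter_univ, hvl, if_true] at hl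
      lia
    · simp only [slot, Finset.mem_filter_univ, hvl, if_false] at hl
      exact ⟨l, hl, hl ▸ hvl⟩
  refine (Finset.ssubset_iff_of_subset fun k hk => ?_).2
    ⟨i, hi, fun h => (hslot i h).elim fun _ hl => hl.2 rfl⟩
  obtain ⟨l, hl, -⟩ := hslot k hk
  exact mem_largeValues.2 ⟨⟨l, hl⟩, (mem_largeValues.1 hk).2⟩

/-- For each `A`, a choice of `d + 1` minors of size `q A` of the flattening along `A`. -/
abbrev MinorFamily (d : ℕ) (q : Finset (Fin d) → ℕ) : Type :=
  ∀ A : Finset (Fin d), Fin (d + 1) → MinorIndex A (q A)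

namespace MinorFamily

variable {q : Finset (Fin d) → ℕ} {c : MinorFamily d q} {n m : ℕ}

/-- The minors of the family are admissible, involve only indices less than `m`, and for each `A`
use pairwise disjoint sets of rows. -/
structure Good (c : MinorFamily d q) (n m : ℕ) : Prop where
  admissible : ∀ A t, (c A t).Admissible n
  indices_subset : ∀ A t, (c A t).indices ⊆ Finset.range m
  disjoint : ∀ A, Pairwise fun t t' => Disjoint (c A t).rows (c A t').rows

variable (K) in
/-- The product of all minors of the family. -/
noncomputable def prod (c : MinorFamily d q) : MvPolynomial (Fin d → ℕ) K :=
  ∏ x : Finset (Fin d) × Fin (d + 1), (c x.1 x.2).minor K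

namespace Good

lemma row_lt (hc : c.Good n m) (A : Finset (Fin d)) (t : Fin (d + 1)) (a : Fin (q A)) :
    (c A t).row a < m :=
  Finset.mem_range.1 (hc.indices_subset A t ((c A t).row_mem_indices a))

lemma col_lt (hc : c.Good n m) (A : Finset (Fin d)) (t : Fin (d + 1)) (b : Fin (q A))
    (l : Fin d) : (c A t).col b l < m :=
  Finset.mem_range.1 (hc.indices_subset A t ((c A t).col_mem_indices b l))

lemma X_slot_col_mem (hc : c.Good n m) {A : Finset (Fin d)} (t : Fin (d + 1)) (b : Fin (q A))
    (i : ℕ) : MvPolynomial.X (slot A i ((c A t).col b)) ∈ (wideParam K d m).range :=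
  X_mem_range_wideParam (i := i) fun l => by
    unfold slot
    split_ifs
    exacts [Or.inr rfl, Or.inl (hc.col_lt A t b l)]

lemma minor_mem_range (hc : c.Good n m) (A : Finset (Fin d)) (t : Fin (d + 1)) :
    (c A t).minor K ∈ (wideParam K d m).range :=
  det_mem_of_forall_mem fun a b => hc.X_slot_col_mem t b ((c A t).row a)

lemma prod_mem_range (hc : c.Good n m) : c.prod K ∈ (wideParam K d m).range :=
  prod_mem fun x _ => hc.minor_mem_range x.1 x.2

lemma exists_mul_minor_eq_prod (hc : c.Good n m) (A : Finset (Fin d)) (t : Fin (d + 1)) :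
    ∃ b ∈ (wideParam K d m).range, b * (c A t).minor K = c.prod K :=
  ⟨∏ x ∈ Finset.univ.erase (A, t), (c x.1 x.2).minor K,
    prod_mem fun x _ => hc.minor_mem_range x.1 x.2,
    Finset.prod_erase_mul _ _ (Finset.mem_univ (A, t))⟩

lemma exists_forall_notMem_rows (hc : c.Good n m) (A : Finset (Fin d)) (v : Fin d → ℕ) :
    ∃ t, ∀ l, v l ∉ (c A t).rows := by
  by_contra! h
  choose l hl using h
  obtain ⟨t, u, hne, heq⟩ := Fintype.exists_ne_map_eq_of_card_lt l (by simp)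
  exact Finset.disjoint_left.1 (hc.disjoint A hne) (hl t) (heq ▸ hl u)

/-- Expanding an admissible minor of size `q A + 1` along a column indexed by `v`, whose first row
is a large value of `v`, expresses `X v` through coordinates with fewer large values. -/
lemma X_mem (hc : c.Good n m) (hn : n ≤ m) {S : Subalgebra K (MvPolynomial (Fin d → ℕ) K)}
    (hwide : (wideParam K d m).range ≤ S)
    (hminor : ∀ A, ∀ μ : MinorIndex A (q A + 1), μ.Admissible n → μ.minor K ∈ S)
    (hdiv : ∀ A t f, (c A t).minor K * f ∈ S → f ∈ S) (v : Fin d → ℕ) :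
    MvPolynomial.X v ∈ S := by
  induction hv : largeValues m v using Finset.strongInduction generalizing v with
  | H L ih =>
    subst hv
    rcases (largeValues m v).eq_empty_or_nonempty with hL | ⟨i, hi⟩
    · refine hwide (X_mem_range_wideParam (i := 0) fun l => Or.inl ?_)
      by_contra! hl
      exact Finset.eq_empty_iff_forall_notMem.1 hL _ (mem_largeValues.2 ⟨⟨l, rfl⟩, hl⟩)
    · let A : Finset (Fin d) := {l | v l = i}
      have hmi : m ≤ i := (mem_largeValues.1 hi).2
      obtain ⟨t, ht⟩ := hc.exists_forall_notMem_rows A v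
      have hadm : ((c A t).cons i v).Admissible n :=
        (hc.admissible A t).cons (hn.trans hmi) (fun l hl h => hl (by simpa [A] using h))
          (fun b l => ((hc.col_lt A t b l).trans_le hmi).ne) ht
      have hmul := mul_det_submatrix_succ_mem (hminor A _ hadm)
        (fun a => ih _ (largeValues_slot_ssubset hi (hc.row_lt A t a)) _ rfl)
        (fun a b => hwide (hc.X_slot_col_mem t b _))
      have hslot : slot A i v = v := slot_eq_self fun l hl => by simpa [A] using hl
      refine hdiv A t _ ?_
      rw [mul_comm, ← hslot]
      exact hmul

lemma exists_pow_mul_sub_mem (hc : c.Good n m) (hn : n ≤ m) (f : MvPolynomial (Fin d → ℕ) K) :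
    ∃ e : ℕ, ∃ g, c.prod K ^ e * f - wideParam K d m g ∈
      PrimeSpectrum.vanishingIdeal (rankLocus K n (q + 1)) := by
  let S := saturation (PrimeSpectrum.vanishingIdeal (rankLocus K n (q + 1)))
    (wideParam K d m).range (c.prod K) hc.prod_mem_range
  have hX : Algebra.adjoin K (Set.range MvPolynomial.X) ≤ S := by
    rw [Algebra.adjoin_le_iff]
    rintro _ ⟨v, rfl⟩
    refine hc.X_mem hn le_saturation (fun A μ hμ => mem_saturation_of_mem_ideal ?_)
      (fun A t f hf => ?_) v
    · exact (PrimeSpectrum.mem_vanishingIdeal _ _).2 fun p hp => hp A μ hμ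
    · obtain ⟨b, hb, hprod⟩ := hc.exists_mul_minor_eq_prod (K := K) A t
      exact mem_saturation_of_mul_mem hb hprod hf
  rw [MvPolynomial.adjoin_range_X] at hX
  obtain ⟨e, _, ⟨g, rfl⟩, hg⟩ := hX (Algebra.mem_top (x := f))
  exact ⟨e, g, hg⟩

lemma isNoetherianUpTo [IsNoetherianRing K] (hc : c.Good n m) (hn : n ≤ m) :
    IsNoetherianUpTo (fixBelow m)
      (rankLocus K n (q + 1) ∩ {p | c.prod K ∉ p.asIdeal}) := by
  intro 𝒞 h𝒞
  let cut (t : Set (Set (PrimeSpectrum (MvPolynomial (Fin d → ℕ) K)))) :=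
    ⋂₀ t ∩ rankLocus K n (q + 1)
  have hclosed : ∀ t ⊆ 𝒞, IsClosed (cut t) := fun t ht =>
    (isClosed_sInter fun C hC => (h𝒞 C (ht hC)).1).inter (isClosed_rankLocus _ _)
  have hstable : ∀ t ⊆ 𝒞, IsStableUnder (fixBelow m) (cut t) := fun t ht =>
    (IsStableUnder.sInter fun C hC => (h𝒞 C (ht hC)).2).inter
      ((isStableUnder_rankLocus _ _).anti (fixBelow_antitone hn))
  let J (t : {t // t ⊆ 𝒞 ∧ t.Finite}) : {I : Ideal (MvPolynomial _ K) // IsColumnStable I} :=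
    ⟨(PrimeSpectrum.vanishingIdeal (cut t)).comap (wideParam K d m),
      isColumnStable_comap_vanishingIdeal (hstable t t.2.1)⟩
  obtain ⟨_, ⟨⟨t, ht, hfin⟩, rfl⟩, hmax⟩ :=
    wellFoundedGT_isColumnStable.wf.has_min (Set.range J) ⟨_, ⟨∅, by simp⟩, rfl⟩
  refine ⟨t, ht, hfin, fun p ⟨hpt, hpY, hp⟩ C hC => ?_⟩
  have hins : insert C t ⊆ 𝒞 := Set.insert_subset hC ht
  have hle : J ⟨t, ht, hfin⟩ ≤ J ⟨insert C t, hins, hfin.insert C⟩ :=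
    Ideal.comap_mono (PrimeSpectrum.vanishingIdeal_anti_mono
      (Set.inter_subset_inter_left _ (Set.sInter_subset_sInter (Set.subset_insert C t))))
  have hge := (hle.eq_of_not_lt (hmax _ ⟨_, rfl⟩)).ge
  exact (inter_subset_of_comap_vanishingIdeal_le (hc.exists_pow_mul_sub_mem hn)
    (hclosed _ hins) Set.inter_subset_right Set.inter_subset_right hge ⟨⟨hpt, hpY⟩, hp⟩).1 C
      (Set.mem_insert C t)

end Good

end MinorFamily

end GoodFamilies

section RankInduction

lemma exists_hitting_or_pairwise_disjoint {α β : Type*} (P : Set α)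
    {rows : α → Finset β} {r : ℕ} (hr : ∀ a, (rows a).card ≤ r) (t : ℕ) :
    (∃ S : Finset β, S.card ≤ t * r ∧ ∀ a ∈ P, ¬Disjoint (rows a) S) ∨
      ∃ c : Fin t → α, (∀ i, c i ∈ P) ∧ Pairwise fun i j => Disjoint (rows (c i)) (rows (c j)) := by
  classical
  induction t with
  | zero => exact Or.inr ⟨Fin.elim0, fun i => i.elim0, fun i => i.elim0⟩
  | succ t ih =>
    rcases ih with ⟨S, hS, hhit⟩ | ⟨c, hcP, hdisj⟩
    · exact Or.inl ⟨S, hS.trans (Nat.mul_le_mul_right r t.le_succ), hhit⟩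
    by_cases hnew : ∃ a ∈ P, ∀ i, Disjoint (rows a) (rows (c i))
    · obtain ⟨a, haP, ha⟩ := hnew
      refine Or.inr ⟨Fin.cons a c, Fin.cases haP hcP, Fin.cases (Fin.cases ?_ ?_) fun i =>
        Fin.cases ?_ fun j hij => ?_⟩
      · exact fun h => (h rfl).elim
      · exact fun j _ => ha j
      · exact fun _ => (ha i).symm
      · exact hdisj fun h => hij (congrArg Fin.succ h)
    · refine Or.inl ⟨Finset.univ.biUnion fun i => rows (c i), ?_, fun a haP hdis => ?_⟩
      · calc _ ≤ t * r := by
              simpa using Finset.card_biUnion_le_card_mul Finset.univ _ r fun i _ => hr (c i)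
          _ ≤ (t + 1) * r := Nat.mul_le_mul_right r t.le_succ
      · exact hnew ⟨a, haP, fun i => hdis.mono_right
          (Finset.subset_biUnion_of_mem (fun i => rows (c i)) (Finset.mem_univ i))⟩

variable {K : Type u} [CommRing K] {d : ℕ} {q : Finset (Fin d) → ℕ} {n : ℕ}
  {p : PrimeSpectrum (MvPolynomial (Fin d → ℕ) K)}

/-- Once a permutation moves the hitting set `S` below `n + s`, a minor with rows above `n + s` no
longer meets it, so it vanishes. -/
lemma exists_smul_mem_rankLocus_update (hp : p ∈ rankLocus K n (q + 1)) {A : Finset (Fin d)}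
    {S : Finset ℕ} {s : ℕ} (hcard : S.card ≤ s)
    (hS : ∀ μ : MinorIndex A (q A), μ.Admissible n → μ.minor K ∉ p.asIdeal → ¬Disjoint μ.rows S) :
    ∃ σ ∈ fixBelow n, σ • p ∈ rankLocus K (n + s) (Function.update (q + 1) A (q A)) := by
  obtain ⟨σ, hσ, hlt⟩ := exists_mem_fixBelow_map_lt n S
  have hadm : ∀ {A' : Finset (Fin d)} {r} {μ : MinorIndex A' r}, μ.Admissible (n + s) →
      (σ⁻¹ • μ).Admissible n := fun hμ => (hμ.mono (Nat.le_add_right n s)).smul (inv_mem hσ)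
  refine ⟨σ, hσ, fun A' => ?_⟩
  rcases eq_or_ne A' A with rfl | hA
  · rw [Function.update_self]
    intro μ hμ
    rw [mem_smul_iff, MinorIndex.tensorRingAct_minor]
    by_contra hne
    obtain ⟨i, hi, hiS⟩ := Finset.not_disjoint_iff.1 (hS _ (hadm hμ) hne)
    obtain ⟨a, -, rfl⟩ := Finset.mem_image.1 hi
    have hsmall : μ.row a < n + S.card := σ.apply_symm_apply (μ.row a) ▸ hlt _ hiS
    exact (hsmall.trans_le (Nat.add_le_add_left hcard n)).not_ge (hμ.le_row a)
  · rw [Function.update_of_ne hA]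
    intro μ hμ
    rw [mem_smul_iff, MinorIndex.tensorRingAct_minor]
    exact hp A' _ (hadm hμ)

namespace MinorFamily

lemma finite_setOf_good (q : Finset (Fin d) → ℕ) (n m : ℕ) :
    {c : MinorFamily d q | c.Good n m}.Finite :=
  (Set.Finite.pi' fun A => Set.Finite.pi' fun _ =>
    MinorIndex.finite_setOf_indices_subset A (q A) (Finset.range m)).subset
      fun _ hc => hc.indices_subset

lemma exists_smul_good {c : MinorFamily d q} (hadm : ∀ A t, (c A t).Admissible n)
    (hdisj : ∀ A, Pairwise fun t t' => Disjoint (c A t).rows (c A t').rows) :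
    ∃ σ ∈ fixBelow n, (σ • c).Good n
      (n + ∑ x : Finset (Fin d) × Fin (d + 1), q x.1 * (d + 1)) := by
  obtain ⟨σ, hσ, hlt⟩ := exists_mem_fixBelow_map_lt n
    (Finset.univ.biUnion fun x : Finset (Fin d) × Fin (d + 1) => (c x.1 x.2).indices)
  refine ⟨σ, hσ, fun A t => (hadm A t).smul hσ, fun A t i hi => ?_, fun A t t' htt' => ?_⟩
  · change i ∈ (σ • c A t).indices at hi
    rw [MinorIndex.indices_smul] at hi
    obtain ⟨j, hj, rfl⟩ := Finset.mem_image.1 hi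
    have hbound := Finset.card_biUnion_le.trans (Finset.sum_le_sum
      fun x (_ : x ∈ (Finset.univ : Finset (Finset (Fin d) × Fin (d + 1)))) =>
        (c x.1 x.2).card_indices_le)
    have hσj := hlt j (Finset.mem_biUnion.2 ⟨(A, t), Finset.mem_univ _, hj⟩)
    exact Finset.mem_range.2 (hσj.trans_le (Nat.add_le_add_left hbound n))
  · change Disjoint (σ • c A t).rows (σ • c A t').rows
    rw [MinorIndex.rows_smul, MinorIndex.rows_smul, Finset.disjoint_image σ.injective]
    exact hdisj A htt'

lemma prod_smul_notMem_smul {c : MinorFamily d q} (hc : ∀ A t, (c A t).minor K ∉ p.asIdeal)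
    (σ : Equiv.Perm ℕ) : (σ • c).prod K ∉ (σ • p).asIdeal := by
  rw [prod, (σ • p).isPrime.prod_mem_iff]
  rintro ⟨x, -, hx⟩
  exact hc x.1 x.2 (MinorIndex.minor_smul_mem_smul_iff.1 hx)

end MinorFamily

lemma exists_smul_mem_rankLocus_update_or_good (hp : p ∈ rankLocus K n (q + 1)) :
    (∃ A, ∃ σ ∈ fixBelow n,
        σ • p ∈ rankLocus K (n + (d + 1) * q A) (Function.update (q + 1) A (q A))) ∨
      ∃ c : MinorFamily d q, c.Good n (n + ∑ x : Finset (Fin d) × Fin (d + 1), q x.1 * (d + 1)) ∧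
        ∃ σ ∈ fixBelow n, σ • p ∈ rankLocus K n (q + 1) ∩ {p | c.prod K ∉ p.asIdeal} := by
  have hdichotomy A := exists_hitting_or_pairwise_disjoint
    {μ : MinorIndex A (q A) | μ.Admissible n ∧ μ.minor K ∉ p.asIdeal}
    MinorIndex.card_rows_le (d + 1)
  by_cases hhit : ∃ A, ∃ S : Finset ℕ, S.card ≤ (d + 1) * q A ∧ ∀ μ : MinorIndex A (q A),
      μ.Admissible n ∧ μ.minor K ∉ p.asIdeal → ¬Disjoint μ.rows S
  · obtain ⟨A, S, hcard, hS⟩ := hhit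
    exact Or.inl ⟨A, exists_smul_mem_rankLocus_update hp hcard fun μ h h' => hS μ ⟨h, h'⟩⟩
  · choose c hc hdisj using fun A => (hdichotomy A).resolve_left fun h => hhit ⟨A, h⟩
    obtain ⟨σ, hσ, hgood⟩ := MinorFamily.exists_smul_good (fun A t => (hc A t).1) hdisj
    exact Or.inr ⟨σ • c, hgood, σ, hσ, isStableUnder_rankLocus _ _ σ hσ p hp,
      MinorFamily.prod_smul_notMem_smul (fun A t => (hc A t).2) σ⟩

theorem isNoetherianUpTo_rankLocus [IsNoetherianRing K] (n : ℕ) (r : Finset (Fin d) → ℕ) :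
    IsNoetherianUpTo (fixBelow n) (rankLocus K n r) := by
  induction r using WellFoundedLT.induction generalizing n with
  | ind r ih =>
    by_cases hzero : ∃ A, r A = 0
    · obtain ⟨A, hA⟩ := hzero
      rw [rankLocus_eq_empty n hA]
      exact fun 𝒞 _ => ⟨∅, Set.empty_subset 𝒞, Set.finite_empty, by simp⟩
    obtain ⟨q, rfl⟩ : ∃ q, r = q + 1 :=
      ⟨r - 1, funext fun A => (Nat.succ_pred_eq_of_ne_zero fun h => hzero ⟨A, h⟩).symm⟩
    let m := n + ∑ x : Finset (Fin d) × Fin (d + 1), q x.1 * (d + 1)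
    have hfinite : Finite {c : MinorFamily d q // c.Good n m} :=
      MinorFamily.finite_setOf_good q n m
    refine IsNoetherianUpTo.of_cover (ι := Finset (Fin d) ⊕ {c : MinorFamily d q // c.Good n m})
      (U := Sum.elim
        (fun A => rankLocus K (n + (d + 1) * q A) (Function.update (q + 1) A (q A)))
        fun c => rankLocus K n (q + 1) ∩ {p | c.1.prod K ∉ p.asIdeal}) ?_ fun p hp => ?_
    · rintro (A | c)
      · exact (ih _ (update_lt_self_iff.2 (Nat.lt_succ_self _)) _).mono
          (fixBelow_antitone (Nat.le_add_right _ _)) subset_rfl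
      · exact (c.2.isNoetherianUpTo (Nat.le_add_right _ _)).mono
          (fixBelow_antitone (Nat.le_add_right _ _)) subset_rfl
    · rcases exists_smul_mem_rankLocus_update_or_good hp with ⟨A, h⟩ | ⟨c, hc, h⟩
      exacts [⟨Sum.inl A, h⟩, ⟨Sum.inr ⟨c, hc⟩, h⟩]

end RankInduction

section Factorization

lemma det_mul_eq_zero_of_card_lt {m n R : Type*} [CommRing R] [Fintype m] [DecidableEq m]
    [Fintype n] (h : Fintype.card n < Fintype.card m) (G : Matrix m n R) (H : Matrix n m R) :
    (G * H).det = 0 := by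
  obtain ⟨f⟩ := Function.Embedding.nonempty_of_card_le h.le
  obtain ⟨a₀, ha₀⟩ := not_forall.1 fun hf =>
    h.not_ge (Fintype.card_le_of_surjective f hf)
  let G' : Matrix m m R := Matrix.of fun a => Function.extend f (G a) 0
  let H' : Matrix m m R := Matrix.of (Function.extend f H 0)
  have hfactor : G * H = G' * H' := by
    ext a b
    refine Fintype.sum_of_injective f f.injective _ _ (fun x hx => ?_) fun e => ?_
    · simp [G', Function.extend_apply' _ _ _ hx]
    · exact congrArg₂ (· * ·) (f.injective.extend_apply (G a) 0 e).symm
        (congrFun (f.injective.extend_apply H 0 e) b).symm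
  rw [hfactor, Matrix.det_mul, Matrix.det_eq_zero_of_column_eq_zero a₀, zero_mul]
  exact fun a => Function.extend_apply' _ _ _ ha₀

lemma exists_aeval_eq_sum_monomials {R B σ κ : Type*} [CommRing R] [CommRing B] [Algebra R B]
    [Fintype κ] [DecidableEq κ] {ι : κ → σ} (hι : Function.Injective ι) {D : ℕ}
    {f : MvPolynomial σ R} (hD : f.totalDegree ≤ D) (y : σ → B) :
    ∃ H : (κ → Fin (D + 1)) → B, ∀ x : σ → B, (∀ s ∈ f.vars, s ∉ Set.range ι → x s = y s) →
      MvPolynomial.aeval x f = ∑ e, (∏ j, x (ι j) ^ (e j : ℕ)) * H e := by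
  classical
  let expo (m : σ →₀ ℕ) (j : κ) : Fin (D + 1) := Fin.ofNat (D + 1) (m (ι j))
  refine ⟨fun e => ∑ m ∈ f.support with expo m = e, algebraMap R B (f.coeff m) *
    ∏ s ∈ m.support with s ∉ Set.range ι, y s ^ m s, fun x hx => ?_⟩
  have hterm : ∀ m ∈ f.support, ∏ s ∈ m.support, x s ^ m s =
      (∏ j, x (ι j) ^ (expo m j : ℕ)) * ∏ s ∈ m.support with s ∉ Set.range ι, y s ^ m s := by
    intro m hm
    have hexpo : ∀ j, (expo m j : ℕ) = m (ι j) := fun j => Nat.mod_eq_of_lt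
      (Nat.lt_succ_of_le ((m.le_degree _).trans ((MvPolynomial.le_totalDegree hm).trans hD)))
    rw [← Finset.prod_filter_mul_prod_filter_not m.support (· ∈ Set.range ι),
      ← Finset.prod_preimage' ι m.support hι.injOn]
    congr 1
    · simp only [hexpo]
      refine Finset.prod_subset (Finset.subset_univ _) fun j _ hj => ?_
      rw [Finset.mem_preimage, Finsupp.notMem_support_iff] at hj
      rw [hj, pow_zero]
    · refine Finset.prod_congr rfl fun s hs => ?_
      obtain ⟨hsm, hs⟩ := Finset.mem_filter.1 hs
      rw [hx s ((MvPolynomial.mem_vars_iff_mem_support _).2 ⟨m, hm, hsm⟩) hs]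
  rw [MvPolynomial.aeval_def, MvPolynomial.eval₂_eq, ← Finset.sum_fiberwise f.support expo]
  refine Finset.sum_congr rfl fun e _ => ?_
  rw [Finset.mul_sum]
  refine Finset.sum_congr rfl fun m hm => ?_
  obtain ⟨hm', rfl⟩ := Finset.mem_filter.1 hm
  rw [hterm m hm']
  ring

end Factorization

section Equivariance

variable {K : Type u} [CommRing K] {k d : ℕ}

/-- The algebraic form of `IsSymEquivariant`, for the homomorphism of coordinate rings. -/
def CommutesWithSym (Φ : MvPolynomial (Fin d → ℕ) K →ₐ[K] MvPolynomial (Fin k × ℕ) K) : Prop :=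
  ∀ σ f, Φ (tensorRingAct K d σ f) = matrixRingAct K k σ (Φ f)

lemma tensorRingAct_X (σ : Equiv.Perm ℕ) (v : Fin d → ℕ) :
    tensorRingAct K d σ (MvPolynomial.X v) = MvPolynomial.X (σ ∘ v) :=
  MvPolynomial.rename_X _ _

lemma exists_forall_le_of_comp_perm_le {α : Type*} [Preorder α] [IsDirectedOrder α] [Nonempty α]
    {g : (Fin d → ℕ) → α} (hg : ∀ (σ : Equiv.Perm ℕ) v, g (σ ∘ v) ≤ g v) : ∃ D, ∀ v, g v ≤ D := by
  obtain ⟨D, hD⟩ := Finite.exists_le fun w : Fin d → Fin d => g (Fin.val ∘ w)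
  refine ⟨D, fun v => ?_⟩
  obtain ⟨σ, -, hσ⟩ := exists_mem_fixBelow_map_lt 0 (Finset.univ.image v)
  have hlt : ∀ l, σ (v l) < d := fun l => by
    have hcard : (Finset.univ.image v).card ≤ d := Finset.card_image_le.trans (Finset.card_fin d).le
    have hσl := hσ (v l) (Finset.mem_image_of_mem v (Finset.mem_univ l))
    lia
  calc g v = g (⇑σ⁻¹ ∘ σ ∘ v) := congrArg g (funext fun l => (σ.symm_apply_apply (v l)).symm)
    _ ≤ g (σ ∘ v) := hg σ⁻¹ _
    _ ≤ D := hD fun l => ⟨σ (v l), hlt l⟩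

namespace CommutesWithSym

variable {Φ : MvPolynomial (Fin d → ℕ) K →ₐ[K] MvPolynomial (Fin k × ℕ) K}

lemma exists_totalDegree_le (hΦ : CommutesWithSym Φ) :
    ∃ D, ∀ v, (Φ (MvPolynomial.X v)).totalDegree ≤ D :=
  exists_forall_le_of_comp_perm_le fun σ v => by
    rw [← tensorRingAct_X, hΦ]
    exact MvPolynomial.totalDegree_rename_le _ _

/-- Otherwise exchanging the column of the variable with a column that does not occur would fix
`X v`, but not its image. -/
lemma mem_range_of_mem_vars (hΦ : CommutesWithSym Φ) {v : Fin d → ℕ} {s : Fin k × ℕ}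
    (hs : s ∈ (Φ (MvPolynomial.X v)).vars) : s.2 ∈ Set.range v := by
  classical
  by_contra hsv
  obtain ⟨c, hc⟩ := Infinite.exists_notMem_finset
    (Finset.univ.image v ∪ (Φ (MvPolynomial.X v)).vars.image Prod.snd)
  simp only [Finset.mem_union, Finset.mem_image, Finset.mem_univ, true_and, not_or] at hc
  have hfix : ⇑(Equiv.swap s.2 c) ∘ v = v := funext fun l =>
    Equiv.swap_apply_of_ne_of_ne (fun h => hsv ⟨l, h⟩) fun h => hc.1 ⟨l, h⟩
  rw [← hfix, ← tensorRingAct_X, hΦ] at hs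
  obtain ⟨s', hs', heq⟩ := MvPolynomial.mem_vars_rename _ _ hs
  have hswap : Equiv.swap s.2 c s'.2 = s.2 := congrArg Prod.snd heq
  exact hc.2 ⟨s', hs', ((Equiv.swap_apply_eq_iff).1 hswap).trans (Equiv.swap_apply_left _ _)⟩

lemma exists_X_slot_eq_sum (hΦ : CommutesWithSym Φ) {D : ℕ}
    (hD : ∀ v, (Φ (MvPolynomial.X v)).totalDegree ≤ D) (A : Finset (Fin d)) (w : Fin d → ℕ) :
    ∃ H : (Fin k → Fin (D + 1)) → MvPolynomial (Fin k × ℕ) K, ∀ i, (∀ l ∉ A, w l ≠ i) →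
      Φ (MvPolynomial.X (slot A i w)) = ∑ e, (∏ j, MvPolynomial.X (j, i) ^ (e j : ℕ)) * H e := by
  obtain ⟨c, hc⟩ := Infinite.exists_notMem_finset (Finset.univ.image w)
  simp only [Finset.mem_image, Finset.mem_univ, true_and, not_exists] at hc
  obtain ⟨H, hH⟩ := exists_aeval_eq_sum_monomials (Prod.mk_left_injective c)
    (hD (slot A c w)) (MvPolynomial.X (R := K))
  refine ⟨H, fun i hi => ?_⟩
  have hslot : ⇑(Equiv.swap c i) ∘ slot A c w = slot A i w := by
    rw [comp_slot, Equiv.swap_apply_left]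
    funext l
    unfold slot
    split_ifs with hl
    exacts [rfl, Equiv.swap_apply_of_ne_of_ne (hc l) (hi l hl)]
  have hcol : ∀ s ∈ (Φ (MvPolynomial.X (slot A c w))).vars,
      s ∉ Set.range (fun j : Fin k => (j, c)) → Equiv.swap c i s.2 = s.2 := by
    intro s hs hsc
    obtain ⟨l, hl⟩ := hΦ.mem_range_of_mem_vars hs
    have hne : s.2 ≠ c := fun h => hsc ⟨s.1, Prod.ext rfl h.symm⟩
    unfold slot at hl
    split_ifs at hl with hlA
    exacts [(hne hl.symm).elim, Equiv.swap_apply_of_ne_of_ne hne (hl ▸ hi l hlA)]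
  have hact (s : Fin k × ℕ) : matrixRingAct K k (Equiv.swap c i) (MvPolynomial.X s) =
      MvPolynomial.X (s.1, Equiv.swap c i s.2) := MvPolynomial.rename_X _ _
  rw [← hslot, ← tensorRingAct_X, hΦ,
    MvPolynomial.aeval_unique (matrixRingAct K k (Equiv.swap c i)), hH _ fun s hs hsc => ?_]
  · simp only [Function.comp_apply, hact, Equiv.swap_apply_left]
  · rw [Function.comp_apply, hact, hcol s hs hsc]

lemma exists_map_minor_eq_zero (hΦ : CommutesWithSym Φ) :
    ∃ r : ℕ, ∀ A (μ : MinorIndex A r), μ.Admissible 0 → Φ (μ.minor K) = 0 := by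
  obtain ⟨D, hD⟩ := hΦ.exists_totalDegree_le
  refine ⟨Fintype.card (Fin k → Fin (D + 1)) + 1, fun A μ hμ => ?_⟩
  choose H hH using fun b => hΦ.exists_X_slot_eq_sum hD A (μ.col b)
  have hfactor : (μ.matrix K).map Φ =
      Matrix.of (fun a e => ∏ j, MvPolynomial.X (j, μ.row a) ^ (e j : ℕ)) *
        Matrix.of fun e b => H b e := by
    ext1 a b
    exact hH b _ (hμ.col_ne_row a b)
  rw [MinorIndex.minor, AlgHom.map_det]
  exact (congrArg Matrix.det hfactor).trans (det_mul_eq_zero_of_card_lt (by simp) _ _)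

end CommutesWithSym

end Equivariance

section Orbits

variable {K : Type u} [CommRing K] {d : ℕ}

lemma mem_commonZeros_symOrbit {f : MvPolynomial (Fin d → ℕ) K}
    {p : PrimeSpectrum (MvPolynomial (Fin d → ℕ) K)} :
    p ∈ commonZeros (symOrbit f) ↔ ∀ σ, tensorRingAct K d σ f ∈ p.asIdeal :=
  Set.range_subset_iff

lemma commonZeros_biUnion_symOrbit (F : Set (MvPolynomial (Fin d → ℕ) K)) :
    commonZeros (⋃ f ∈ F, symOrbit f) = ⋂ f ∈ F, commonZeros (symOrbit f) :=
  PrimeSpectrum.zeroLocus_iUnion₂ fun f (_ : f ∈ F) => symOrbit f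

lemma isStableUnder_commonZeros_symOrbit (H : Subgroup (Equiv.Perm ℕ))
    (f : MvPolynomial (Fin d → ℕ) K) :
    IsStableUnder (X := PrimeSpectrum _) H (commonZeros (symOrbit f)) := by
  refine fun σ _ p hp => mem_commonZeros_symOrbit.2 fun τ => ?_
  rw [mem_smul_iff, ← AlgHom.comp_apply, ← tensorRingAct_mul]
  exact mem_commonZeros_symOrbit.1 hp _

lemma exists_finite_zeroLocus_eq_commonZeros {H : Subgroup (Equiv.Perm ℕ)}
    {F₀ : Set (MvPolynomial (Fin d → ℕ) K)} (hF₀ : F₀.Finite)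
    (hnoeth : IsNoetherianUpTo (X := PrimeSpectrum _) H (commonZeros (⋃ f ∈ F₀, symOrbit f)))
    {I : Ideal (MvPolynomial (Fin d → ℕ) K)} (hI : ∀ σ, ∀ f ∈ I, tensorRingAct K d σ f ∈ I)
    (hF₀I : F₀ ⊆ I) :
    ∃ F : Set (MvPolynomial (Fin d → ℕ) K), F.Finite ∧
      PrimeSpectrum.zeroLocus I = commonZeros (⋃ f ∈ F, symOrbit f) := by
  obtain ⟨t, ht, hfin, hcut⟩ := hnoeth ((fun f => commonZeros (symOrbit f)) '' I) (by
    rintro _ ⟨f, -, rfl⟩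
    exact ⟨PrimeSpectrum.isClosed_zeroLocus _, isStableUnder_commonZeros_symOrbit H f⟩)
  obtain ⟨E, hEI, hE, rfl⟩ := Set.exists_subset_image_finite_and.1 ⟨t, ht, hfin, rfl⟩
  refine ⟨F₀ ∪ E, hF₀.union hE, Set.Subset.antisymm (fun p hp => ?_) fun p hp f hf => ?_⟩
  · rw [commonZeros_biUnion_symOrbit]
    exact Set.mem_iInter₂.2 fun f hf => mem_commonZeros_symOrbit.2 fun σ =>
      hp (hI σ f (Set.union_subset hF₀I hEI hf))
  · rw [Set.biUnion_union, commonZeros, PrimeSpectrum.zeroLocus_union] at hp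
    have hpE : p ∈ ⋂₀ ((fun f => commonZeros (symOrbit f)) '' E) := by
      rw [Set.sInter_image, ← commonZeros_biUnion_symOrbit]
      exact hp.2
    have hfp := mem_commonZeros_symOrbit.1 (hcut ⟨hpE, hp.1⟩ _ ⟨f, hf, rfl⟩) 1
    rwa [tensorRingAct_one] at hfp

lemma exists_finite_minors_commonZeros_subset_rankLocus (r : ℕ) :
    ∃ F ⊆ {f | ∃ A, ∃ μ : MinorIndex A r, μ.Admissible 0 ∧ μ.minor K = f}, F.Finite ∧
      commonZeros (⋃ f ∈ F, symOrbit f) ⊆ rankLocus K (d := d) 0 fun _ => r := by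
  let M (A : Finset (Fin d)) : Set (MinorIndex A r) :=
    {μ | μ.indices ⊆ Finset.range (r * (d + 1)) ∧ μ.Admissible 0}
  refine ⟨⋃ A, (MinorIndex.minor K) '' M A, ?_, ?_, fun p hp A μ hμ => ?_⟩
  · rintro _ ⟨_, ⟨A, rfl⟩, μ, hμ, rfl⟩
    exact ⟨A, μ, hμ.2, rfl⟩
  · exact Set.finite_iUnion fun A => ((MinorIndex.finite_setOf_indices_subset A r _).subset
      fun μ hμ => hμ.1).image _
  · obtain ⟨σ, hσ, hlt⟩ := exists_mem_fixBelow_map_lt 0 μ.indices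
    have hmem : σ • μ ∈ M A := by
      refine ⟨?_, hμ.smul hσ⟩
      rw [MinorIndex.indices_smul, Finset.image_subset_iff]
      exact fun i hi => Finset.mem_range.2
        ((hlt i hi).trans_le ((zero_add _).trans_le μ.card_indices_le))
    rw [commonZeros_biUnion_symOrbit] at hp
    have hmem := mem_commonZeros_symOrbit.1
      (Set.mem_iInter₂.1 hp _ (Set.mem_iUnion_of_mem A ⟨_, hmem, rfl⟩)) σ⁻¹
    rwa [MinorIndex.tensorRingAct_minor, inv_smul_smul] at hmem

lemma isTopSymNoetherian_of_isNoetherianUpTo {H : Subgroup (Equiv.Perm ℕ)}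
    {Y Z : Set (PrimeSpectrum (MvPolynomial (Fin d → ℕ) K))} (hY : IsNoetherianUpTo H Y)
    (hZ : Z ⊆ Y) : IsTopSymNoetherian (K := K) (d := d) Z :=
  fun _ hclosed hstable hsub hanti =>
    hY.exists_eq_of_antitone hclosed (fun n σ _ _ hp => hstable n σ hp)
      (fun n => (hsub n).trans hZ) hanti

end Orbits

section Schemes

variable {K : Type u} [CommRing K] {k d : ℕ} {φ : matrixScheme K k ⟶ tensorScheme K d}
  {Φ : MvPolynomial (Fin d → ℕ) K →ₐ[K] MvPolynomial (Fin k × ℕ) K}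

lemma exists_algHom_left_eq_specMap (φ : matrixScheme K k ⟶ tensorScheme K d) :
    ∃ Φ : MvPolynomial (Fin d → ℕ) K →ₐ[K] MvPolynomial (Fin k × ℕ) K,
      φ.left = Spec.map (CommRingCat.ofHom Φ.toRingHom) := by
  obtain ⟨F, hF⟩ := Spec.map_surjective φ.left
  have hbase := Over.w φ
  dsimp only [Over.mk_hom] at hbase
  rw [← hF, ← Spec.map_comp] at hbase
  have hcomm := Spec.map_injective hbase
  exact ⟨{ F.hom with commutes' := fun a => congrArg (fun g => g.hom a) hcomm }, hF.symm⟩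

lemma IsSymEquivariant.commutesWithSym (hφ : IsSymEquivariant φ)
    (hΦ : φ.left = Spec.map (CommRingCat.ofHom Φ.toRingHom)) : CommutesWithSym Φ := by
  intro σ f
  have h := congrArg Over.Hom.left (hφ σ⁻¹)
  rw [Over.comp_left, Over.comp_left, hΦ] at h
  change Spec.map (CommRingCat.ofHom (matrixRingAct K k σ⁻¹⁻¹).toRingHom) ≫ Spec.map _ =
    Spec.map _ ≫ Spec.map (CommRingCat.ofHom (tensorRingAct K d σ⁻¹⁻¹).toRingHom) at h
  rw [← Spec.map_comp, ← Spec.map_comp, inv_inv] at h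
  exact (congrArg (fun g => g.hom f) (Spec.map_injective h)).symm

lemma imageClosure_eq_zeroLocus_ker (hΦ : φ.left = Spec.map (CommRingCat.ofHom Φ.toRingHom)) :
    imageClosure φ = PrimeSpectrum.zeroLocus (RingHom.ker Φ.toRingHom) := by
  rw [imageClosure, hΦ]
  exact PrimeSpectrum.closure_range_comap _

end Schemes

theorem mainTheorem2 (K : Type u) [CommRing K] [IsNoetherianRing K] (k d : ℕ)
    (φ : matrixScheme K k ⟶ tensorScheme K d) (hφ : IsSymEquivariant φ) :
    (∃ F : Set (MvPolynomial (Fin d → ℕ) K), F.Finite ∧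
      imageClosure φ = commonZeros (⋃ f ∈ F, symOrbit f)) ∧
    IsTopSymNoetherian (imageClosure φ) := by
  obtain ⟨Φ, hΦ⟩ := exists_algHom_left_eq_specMap φ
  have hcomm := hφ.commutesWithSym hΦ
  obtain ⟨r, hr⟩ := hcomm.exists_map_minor_eq_zero
  have hnoeth := isNoetherianUpTo_rankLocus (K := K) (d := d) 0 fun _ => r
  rw [imageClosure_eq_zeroLocus_ker hΦ]
  constructor
  · obtain ⟨F₀, hminors, hF₀, hsub⟩ :=
      exists_finite_minors_commonZeros_subset_rankLocus (K := K) (d := d) r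
    have hker : ∀ σ, ∀ f ∈ RingHom.ker Φ.toRingHom,
        tensorRingAct K d σ f ∈ RingHom.ker Φ.toRingHom := fun σ f (hf : Φ f = 0) =>
      (hcomm σ f).trans ((congrArg _ hf).trans (map_zero _))
    refine exists_finite_zeroLocus_eq_commonZeros hF₀ (hnoeth.mono le_rfl hsub) hker fun f hf => ?_
    obtain ⟨A, μ, hμ, rfl⟩ := hminors hf
    exact hr A μ hμ
  · exact isTopSymNoetherian_of_isNoetherianUpTo hnoeth fun p hp A μ hμ => hp (hr A μ hμ)
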